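/- Let $\lambda,c>0$ and $p,q\ge 0$ with $p+q<1$. A particle starts at the origin of the plane at time $0$ and moves with speed $c$ along the directions $d_j=(\cos\frac{\pi j}{2},\sin\frac{\pi j}{2})$, where $j$ is taken modulo $4$; its initial direction is uniformly distributed on $\{d_0,d_1,d_2,d_3\}$. At the events of a Poisson process of intensity $\lambda$, independent of the initial direction, the direction changes: independently of everything else, it passes from $d_j$ to $d_{j+1}$ with probability $p$, to $d_{j-1}$ with probability $q$, and to $d_{j+2}$ (reflection) with probability $1-p-q$. Let $(X(t),Y(t))$ be the position at time $t$, and let $I_0(z)=\sum_{k\ge 0}\frac{(z/2)^{2k}}{(k!)^2}$ be the modified Bessel function of order $0$. Then for every $t>0$ the function $$g(x,t)=\frac{e^{-\lambda t}}{4c}\left[\lambda(1-p-q)\,I_0\!\left(\tfrac{\lambda}{c}(1-p-q)\sqrt{c^2t^2-x^2}\right)+\frac{\partial}{\partial t}I_0\!\left(\tfrac{\lambda}{c}(1-p-q)\sqrt{c^2t^2-x^2}\right)\right],\qquad |x|<ct,$$ is well defined (the time derivative exists), nonnegative and continuous in $x$, and it is the density of $X(t)$ on the event $\{Y(t)=0\}$: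 for every Borel set $B\subseteq(-ct,ct)$, $$\mathbb{P}\big(X(t)\in B,\;Y(t)=0\big)=\int_B g(x,t)\,dx.$$ -/

import Mathlib

open MeasureTheory ProbabilityTheory Set

noncomputable section

/-- The modified Bessel function of the first kind of order zero,
`I₀(z) = ∑ₖ (z/2)^(2k) / (k!)²`. -/
def besselI0 (z : ℝ) : ℝ :=
  ∑' k : ℕ, (z / 2) ^ (2 * k) / ((Nat.factorial k : ℝ)) ^ 2

namespace PlanarMotion

/-- The driving randomness of the planar motion. The four directions are indexed by integers
modulo `4`, via `d_j = (cos (π j / 2), sin (π j / 2))`.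
* `J₀` is the index of the initial direction, uniform on `{0, 1, 2, 3}`;
* `τ 0, τ 1, …` are the interarrival times of the changes of direction: they are i.i.d.
  exponential of rate `lam`, so that the changes form a Poisson process of intensity `lam`;
* `ξ 0, ξ 1, …` are the successive turns, i.i.d.: `+1` (counter-clockwise) with probability `p`,
  `-1` (clockwise) with probability `q`, `+2` (reflection) with probability `1 - p - q`;
* the initial direction, the interarrival times and the turns are independent. -/
structure IsDriving {Ω : Type*} [MeasurableSpace Ω] (P : Measure Ω) (lam p q : ℝ)
    (J₀ : Ω → ℤ) (τ : ℕ → Ω → ℝ) (ξ : ℕ → Ω → ℤ) : Prop where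
  measurable_init : Measurable J₀
  measurable_time : ∀ n, Measurable (τ n)
  measurable_turn : ∀ n, Measurable (ξ n)
  law_init : ∀ j : ℤ, 0 ≤ j → j ≤ 3 → P {ω | J₀ ω = j} = 1 / 4
  law_time : ∀ n, P.map (τ n) = expMeasure lam
  law_counterclockwise : ∀ n, P {ω | ξ n ω = 1} = ENNReal.ofReal p
  law_clockwise : ∀ n, P {ω | ξ n ω = -1} = ENNReal.ofReal q
  law_reflection : ∀ n, P {ω | ξ n ω = 2} = ENNReal.ofReal (1 - p - q)
  indep_time : iIndepFun τ P
  indep_turn : iIndepFun ξ P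
  indep_time_turn : IndepFun (fun ω n => τ n ω) (fun ω n => ξ n ω) P
  indep_init : IndepFun J₀ (fun ω => ((fun n => τ n ω), (fun n => ξ n ω))) P

variable {Ω : Type*}

/-- The time of the `n`-th change of direction (`n ≥ 1`), and `0` for `n = 0`. -/
def arrival (τ : ℕ → Ω → ℝ) (n : ℕ) (ω : Ω) : ℝ :=
  ∑ k ∈ Finset.range n, τ k ω

/-- `N(t)`: the number of changes of direction up to time `t` (almost surely finite; the junk
value `0` is used on the null event that there are infinitely many). -/
def count (τ : ℕ → Ω → ℝ) (t : ℝ) (ω : Ω) : ℕ :=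
  Set.ncard {n : ℕ | 1 ≤ n ∧ arrival τ n ω ≤ t}

/-- The index of the direction `D(t)`: the initial one, shifted by the first `N(t)` turns. -/
def dirIndex (J₀ : Ω → ℤ) (τ : ℕ → Ω → ℝ) (ξ : ℕ → Ω → ℤ) (t : ℝ) (ω : Ω) : ℤ :=
  J₀ ω + ∑ k ∈ Finset.range (count τ t ω), ξ k ω

/-- The abscissa `X(t)` of the particle, which starts at the origin and moves with speed `c`. -/
def posX (c : ℝ) (J₀ : Ω → ℤ) (τ : ℕ → Ω → ℝ) (ξ : ℕ → Ω → ℤ) (t : ℝ) (ω : Ω) : ℝ :=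
  ∫ s in (0 : ℝ)..t, c * Real.cos (Real.pi / 2 * (dirIndex J₀ τ ξ s ω : ℝ))

/-- The ordinate `Y(t)` of the particle. -/
def posY (c : ℝ) (J₀ : Ω → ℤ) (τ : ℕ → Ω → ℝ) (ξ : ℕ → Ω → ℤ) (t : ℝ) (ω : Ω) : ℝ :=
  ∫ s in (0 : ℝ)..t, c * Real.sin (Real.pi / 2 * (dirIndex J₀ τ ξ s ω : ℝ))

/-- `I₀((λ/c)(1-p-q)√(c²t²-x²))`. -/
def besselTerm (lam c p q x t : ℝ) : ℝ :=
  besselI0 (lam / c * (1 - p - q) * Real.sqrt (c ^ 2 * t ^ 2 - x ^ 2))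

/-- `g(x,t) = e^{-λt}/(4c) [λ(1-p-q) I₀(…) + ∂ₜ I₀(…)]`. -/
def diagDensity (lam c p q x t : ℝ) : ℝ :=
  Real.exp (-lam * t) / (4 * c) *
    (lam * (1 - p - q) * besselTerm lam c p q x t
      + deriv (fun s => besselTerm lam c p q x s) t)

end PlanarMotion

end

/-!
Almost surely the durations `τ 0, τ 1, …` and the time `t` are linearly independent over `ℤ`, so
that `Y(t) = 0` forces every flight to be horizontal: the initial direction is `d₀` or `d₂` and all
turns up to time `t` are reflections. The flights then alternate between two opposite directions,
and `X(t) = ± c (t - 2 W)`, where `W` is the total duration of the flights that go against the last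
direction. For `n` reflections, `W` is the sum of `⌈n / 2⌉` of the durations, hence a gamma
variable, and independently of it the other `⌊n / 2⌋` completed flights form a Poisson process that
is observed during the time `t - W`. Summing the resulting densities over `n` gives the power series
of `I₀` and of its time derivative.
-/

noncomputable section

section PowerSeries

variable {𝕜 : Type*} [RCLike 𝕜]

theorem summable_natCast_mul_pow_pred {a : ℕ → 𝕜} (ha : ∀ z, Summable fun k => a k * z ^ k)
    (R : ℝ) : Summable fun k : ℕ => ‖a k‖ * (k * R ^ (k - 1)) := by
  set S : ℝ := |R| + 1
  have hS : 1 ≤ S := le_add_of_nonneg_left (abs_nonneg R)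
  refine Summable.of_norm_bounded (ha ((2 * S : ℝ) : 𝕜)).norm fun k => ?_
  have hk : (k : ℝ) ≤ 2 ^ k := mod_cast Nat.lt_two_pow_self.le
  have hpow : |R| ^ (k - 1) ≤ S ^ k :=
    (pow_le_pow_left₀ (abs_nonneg R) (le_add_of_nonneg_right zero_le_one) _).trans
      (pow_le_pow_right₀ hS (Nat.sub_le k 1))
  calc ‖‖a k‖ * (k * R ^ (k - 1))‖ = ‖a k‖ * (k * |R| ^ (k - 1)) := by
        simp only [norm_mul, norm_pow, Real.norm_eq_abs, abs_norm, Nat.abs_cast]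
    _ ≤ ‖a k‖ * (2 ^ k * S ^ k) := by gcongr
    _ = ‖a k * ((2 * S : ℝ) : 𝕜) ^ k‖ := by
        rw [norm_mul, norm_pow, RCLike.norm_of_nonneg (by positivity), mul_pow]

theorem hasDerivAt_tsum_mul_pow {a : ℕ → 𝕜} (ha : ∀ z, Summable fun k => a k * z ^ k) (y : 𝕜) :
    HasDerivAt (fun z => ∑' k, a k * z ^ k) (∑' k : ℕ, (k + 1) * a (k + 1) * y ^ k) y := by
  have hbound (z : 𝕜) (k : ℕ) {R : ℝ} (hz : ‖z‖ ≤ R) :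
      ‖a k * (k * z ^ (k - 1))‖ ≤ ‖a k‖ * (k * R ^ (k - 1)) := by
    rw [norm_mul, norm_mul, norm_pow, RCLike.norm_natCast]
    gcongr
  have hder := hasDerivAt_tsum_of_isPreconnected (g := fun k z => a k * z ^ k)
    (summable_natCast_mul_pow_pred ha (‖y‖ + 1)) Metric.isOpen_ball
    (Metric.isPreconnected_ball (x := (0 : 𝕜)) (r := ‖y‖ + 1))
    (fun k z _ => (hasDerivAt_pow k z).const_mul (a k))
    (fun k z hz => hbound z k (mem_ball_zero_iff.1 hz).le)
    (Metric.mem_ball_self (by positivity)) (ha 0) (mem_ball_zero_iff.2 (lt_add_one _))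
  refine hder.congr_deriv ?_
  have hsummable : Summable fun k => a k * (k * y ^ (k - 1)) :=
    .of_norm_bounded (summable_natCast_mul_pow_pred ha ‖y‖) fun k => hbound y k le_rfl
  rw [hsummable.tsum_eq_zero_add]
  simp only [Nat.cast_zero, zero_mul, mul_zero, zero_add, Nat.cast_succ, Nat.add_sub_cancel]
  exact tsum_congr fun k => by ring

end PowerSeries

section BesselClifford

/-- The Bessel–Clifford function `∑ₖ y ^ k / (k! (k + n)!)`: the entire function for which
`I_n(z) = (z / 2) ^ n * besselClifford n (z ^ 2 / 4)`. Unlike `I_n`, it can be evaluated without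
extracting the square root of `y`. -/
def besselClifford (n : ℕ) (y : ℝ) : ℝ :=
  ∑' k : ℕ, ((k.factorial : ℝ) * ((k + n).factorial : ℝ))⁻¹ * y ^ k

theorem summable_besselClifford (n : ℕ) (y : ℝ) :
    Summable fun k : ℕ => ((k.factorial : ℝ) * ((k + n).factorial : ℝ))⁻¹ * y ^ k := by
  refine Summable.of_norm_bounded (Real.summable_pow_div_factorial |y|) fun k => ?_
  have hfac : (k.factorial : ℝ) ≤ k.factorial * (k + n).factorial :=
    le_mul_of_one_le_right (by positivity) (mod_cast (k + n).factorial_pos)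
  rw [norm_mul, norm_pow, Real.norm_of_nonneg (by positivity), Real.norm_eq_abs, inv_mul_eq_div]
  gcongr

theorem hasDerivAt_besselClifford (n : ℕ) (y : ℝ) :
    HasDerivAt (besselClifford n) (besselClifford (n + 1) y) y := by
  refine (hasDerivAt_tsum_mul_pow (summable_besselClifford n) y).congr_deriv ?_
  refine tsum_congr fun k => ?_
  rw [Nat.factorial_succ k, show k + 1 + n = k + (n + 1) by ring]
  push_cast
  field_simp

theorem continuous_besselClifford (n : ℕ) : Continuous (besselClifford n) :=
  continuous_iff_continuousAt.2 fun y => (hasDerivAt_besselClifford n y).continuousAt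

theorem besselClifford_nonneg (n : ℕ) {y : ℝ} (hy : 0 ≤ y) : 0 ≤ besselClifford n y :=
  tsum_nonneg fun _ => by positivity

theorem besselI0_eq_besselClifford (z : ℝ) : besselI0 z = besselClifford 0 (z ^ 2 / 4) := by
  refine tsum_congr fun k => ?_
  rw [add_zero, pow_mul, div_pow, ← pow_two, inv_mul_eq_div]
  norm_num

end BesselClifford

namespace PlanarMotion

section DiagDensity

variable {lam c p q x t : ℝ}

theorem sq_sub_div_sq_pos (hc : 0 < c) (hx : |x| < c * t) : 0 < t ^ 2 - (x / c) ^ 2 := by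
  have hlt : |x / c| < t := by rwa [abs_div, abs_of_pos hc, div_lt_iff₀' hc]
  exact sub_pos.2 (sq_lt_sq' (neg_lt_of_abs_lt hlt) (lt_of_abs_lt hlt))

theorem besselTerm_eq (hc : 0 < c) (h : 0 ≤ t ^ 2 - (x / c) ^ 2) :
    besselTerm lam c p q x t =
      besselClifford 0 ((lam * (1 - p - q) / 2) ^ 2 * (t ^ 2 - (x / c) ^ 2)) := by
  have hfactor : c ^ 2 * t ^ 2 - x ^ 2 = c ^ 2 * (t ^ 2 - (x / c) ^ 2) := by field_simp
  rw [besselTerm, besselI0_eq_besselClifford, mul_pow, Real.sq_sqrt (by rw [hfactor]; positivity),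
    hfactor]
  congr 1
  field_simp
  norm_num

theorem hasDerivAt_besselTerm (hc : 0 < c) (hx : |x| < c * t) :
    HasDerivAt (fun s => besselTerm lam c p q x s)
      (besselClifford 1 ((lam * (1 - p - q) / 2) ^ 2 * (t ^ 2 - (x / c) ^ 2)) *
        ((lam * (1 - p - q)) ^ 2 * t / 2)) t := by
  have hcont : ContinuousAt (fun s : ℝ => s ^ 2 - (x / c) ^ 2) t := by fun_prop
  have heq : (fun s => besselTerm lam c p q x s) =ᶠ[nhds t] fun s =>
      besselClifford 0 ((lam * (1 - p - q) / 2) ^ 2 * (s ^ 2 - (x / c) ^ 2)) := by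
    filter_upwards [hcont.eventually (lt_mem_nhds (sq_sub_div_sq_pos hc hx))] with s hs
      using besselTerm_eq hc hs.le
  have harg : HasDerivAt (fun s : ℝ => (lam * (1 - p - q) / 2) ^ 2 * (s ^ 2 - (x / c) ^ 2))
      ((lam * (1 - p - q)) ^ 2 * t / 2) t :=
    (((hasDerivAt_pow 2 t).sub_const _).const_mul _).congr_deriv (by norm_num; ring)
  exact ((hasDerivAt_besselClifford 0 _).comp t harg).congr_of_eventuallyEq heq

theorem diagDensity_eq (hc : 0 < c) (hx : |x| < c * t) :
    diagDensity lam c p q x t = Real.exp (-lam * t) / (4 * c) *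
      (lam * (1 - p - q) *
          besselClifford 0 ((lam * (1 - p - q) / 2) ^ 2 * (t ^ 2 - (x / c) ^ 2)) +
        besselClifford 1 ((lam * (1 - p - q) / 2) ^ 2 * (t ^ 2 - (x / c) ^ 2)) *
          ((lam * (1 - p - q)) ^ 2 * t / 2)) := by
  rw [diagDensity, (hasDerivAt_besselTerm hc hx).deriv,
    besselTerm_eq hc (sq_sub_div_sq_pos hc hx).le]

theorem diagDensity_nonneg (hlam : 0 ≤ lam) (hc : 0 < c) (hpq : p + q ≤ 1)
    (hx : |x| < c * t) : 0 ≤ diagDensity lam c p q x t := by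
  have ht : 0 < t := pos_of_mul_pos_right ((abs_nonneg x).trans_lt hx) hc.le
  have hr : 0 ≤ 1 - p - q := by linarith
  have harg : 0 ≤ (lam * (1 - p - q) / 2) ^ 2 * (t ^ 2 - (x / c) ^ 2) :=
    mul_nonneg (sq_nonneg _) (sq_sub_div_sq_pos hc hx).le
  have h₀ := besselClifford_nonneg 0 harg
  have h₁ := besselClifford_nonneg 1 harg
  rw [diagDensity_eq hc hx]
  positivity

theorem continuousOn_diagDensity (hc : 0 < c) :
    ContinuousOn (fun x => diagDensity lam c p q x t) (Ioo (-(c * t)) (c * t)) := by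
  have h₀ := continuous_besselClifford 0
  have h₁ := continuous_besselClifford 1
  refine ContinuousOn.congr (Continuous.continuousOn ?_) fun x hx => diagDensity_eq hc (abs_lt.2 hx)
  fun_prop

end DiagDensity

section FlightDensity

/-- The density at `w` of the total duration of `a + 1` exponential flights, on the event that the
time `t` falls in the flight that follows these and `b` further ones. -/
def flightDensity (lam t : ℝ) (a b : ℕ) (w : ℝ) : ℝ :=
  lam ^ (a + 1 + b) * Real.exp (-lam * t) * (w ^ a / a.factorial) * ((t - w) ^ b / b.factorial)

variable {lam c p q x t w : ℝ}

theorem flightDensity_nonneg (hlam : 0 ≤ lam) (a b : ℕ) (hw : w ∈ Icc 0 t) :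
    0 ≤ flightDensity lam t a b w := by
  have h₀ : 0 ≤ w := hw.1
  have h₁ : 0 ≤ t - w := sub_nonneg.2 hw.2
  rw [flightDensity]
  positivity

@[fun_prop]
theorem continuous_flightDensity (a b : ℕ) : Continuous (flightDensity lam t a b) := by
  unfold flightDensity
  fun_prop

/-- Odd numbers of reflections account for the series of `I₀`, even ones for that of its
derivative. -/
theorem hasSum_diagDensity (hc : 0 < c) (hx : |x| < c * t) :
    HasSum (fun n : ℕ => 1 / 4 * (1 - p - q) ^ (n + 1) * (1 / (2 * c) *
        (flightDensity lam t (n / 2) ((n + 1) / 2) ((t + x / c) / 2) +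
          flightDensity lam t (n / 2) ((n + 1) / 2) ((t - x / c) / 2))))
      (diagDensity lam c p q x t) := by
  rw [diagDensity_eq hc hx]
  set r := 1 - p - q
  set u := (t + x / c) / 2 with hu
  set v := (t - x / c) / 2 with hv
  have huv : u + v = t := by rw [hu, hv]; ring
  have harg : (lam * r / 2) ^ 2 * (t ^ 2 - (x / c) ^ 2) = (lam * r) ^ 2 * (u * v) := by
    rw [hu, hv]; ring
  rw [harg, mul_add, mul_comm (besselClifford 1 _),
    ← mul_assoc _ _ (besselClifford 0 _), ← mul_assoc _ _ (besselClifford 1 _)]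
  have hseries (n : ℕ) : HasSum
      (fun k : ℕ => ((k.factorial : ℝ) * (k + n).factorial)⁻¹ * ((lam * r) ^ 2 * (u * v)) ^ k)
      (besselClifford n ((lam * r) ^ 2 * (u * v))) := (summable_besselClifford n _).hasSum
  refine HasSum.even_add_odd (((hseries 0).mul_left _).congr_fun fun k => ?_)
    (((hseries 1).mul_left _).congr_fun fun k => ?_)
  · have hhalf : 2 * k / 2 = k ∧ (2 * k + 1) / 2 = k := by omega
    simp only [flightDensity, hhalf, add_zero, ← huv, add_sub_cancel_left, add_sub_cancel_right]
    field_simp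
    simp only [mul_pow, ← pow_mul]
    ring
  · have hhalf : (2 * k + 1) / 2 = k ∧ (2 * k + 1 + 1) / 2 = k + 1 := by omega
    simp only [flightDensity, hhalf, ← huv, add_sub_cancel_left, add_sub_cancel_right]
    field_simp
    simp only [mul_pow, ← pow_mul]
    ring

end FlightDensity

end PlanarMotion

section ChangeOfVariables

theorem setLIntegral_preimage_mul_add {a : ℝ} (ha : a ≠ 0) (b : ℝ) (B : Set ℝ) (f : ℝ → ENNReal) :
    ∫⁻ w in (fun w => a * w + b) ⁻¹' B, f w =
      ENNReal.ofReal |a⁻¹| * ∫⁻ x in B, f ((x - b) / a) := by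
  have hemb : MeasurableEmbedding fun w : ℝ => a * w + b :=
    (measurableEmbedding_addRight b).comp (measurableEmbedding_mulLeft₀ ha)
  have hmap : (volume : Measure ℝ).map (fun w => a * w + b) = ENNReal.ofReal |a⁻¹| • volume := by
    rw [← Function.comp_def (· + b) (a * ·), ← Measure.map_map (by fun_prop) (by fun_prop),
      Real.map_volume_mul_left ha, Measure.map_smul, map_add_right_eq_self]
  calc ∫⁻ w in (fun w => a * w + b) ⁻¹' B, f w
      = ∫⁻ w in (fun w => a * w + b) ⁻¹' B, f ((a * w + b - b) / a) := by
        simp only [add_sub_cancel_right, mul_div_cancel_left₀ _ ha]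
    _ = ∫⁻ x in B, f ((x - b) / a) ∂(volume.map fun w => a * w + b) := by
        rw [hemb.restrict_map, hemb.lintegral_map]
    _ = ENNReal.ofReal |a⁻¹| * ∫⁻ x in B, f ((x - b) / a) := by
        rw [hmap, Measure.restrict_smul, lintegral_smul_measure, smul_eq_mul]

end ChangeOfVariables

section Gamma

variable {a b r : ℝ}

theorem gammaPDF_mul_gammaPDF_sub (ha : 0 < a) (hb : 0 < b) (hr : 0 < r) {x y : ℝ} (hx : 0 < x)
    (hy₀ : y ≠ 0) (hyx : y ≠ x) :
    gammaPDF a r y * gammaPDF b r (x - y) =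
      gammaPDF (a + b) r x * (ENNReal.ofReal |x⁻¹| * betaPDF a b (y / x)) := by
  rcases hy₀.lt_or_gt with hy | hy
  · rw [gammaPDF_of_neg hy, betaPDF_eq_zero_of_nonpos (div_nonpos_of_nonpos_of_nonneg hy.le hx.le)]
    simp only [zero_mul, mul_zero]
  rcases hyx.lt_or_gt with hyx | hxy
  · have hsub : 0 < x - y := sub_pos.2 hyx
    have hone : 1 - y / x = (x - y) / x := by rw [sub_div, div_self hx.ne']
    have hpow : x ^ (a + b - 1) = x * (x ^ (a - 1) * x ^ (b - 1)) := by
      rw [show a + b - 1 = 1 + ((a - 1) + (b - 1)) by ring, Real.rpow_add hx, Real.rpow_add hx,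
        Real.rpow_one]
    have hexp : Real.exp (-(r * x)) = Real.exp (-(r * y)) * Real.exp (-(r * (x - y))) := by
      rw [← Real.exp_add]
      ring_nf
    have hΓ := (Real.Gamma_pos_of_pos ha).ne'
    have hΓ' := (Real.Gamma_pos_of_pos hb).ne'
    have hΓ'' := (Real.Gamma_pos_of_pos (add_pos ha hb)).ne'
    rw [gammaPDF_of_nonneg hy.le, gammaPDF_of_nonneg hsub.le, gammaPDF_of_nonneg hx.le,
      betaPDF_of_pos_lt_one (div_pos hy hx) ((div_lt_one hx).2 hyx), abs_of_pos (inv_pos.2 hx),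
      ← ENNReal.ofReal_mul (by positivity), ← ENNReal.ofReal_mul (by positivity),
      ← ENNReal.ofReal_mul (by positivity), hone, Real.div_rpow hy.le hx.le,
      Real.div_rpow hsub.le hx.le, Real.rpow_add hr, hpow, hexp, beta]
    congr 1
    field_simp
  · rw [gammaPDF_of_neg (sub_neg.2 hxy), betaPDF_eq_zero_of_one_le ((one_le_div hx).2 hxy.le)]
    simp only [mul_zero]

theorem lconvolution_gammaPDF (ha : 0 < a) (hb : 0 < b) (hr : 0 < r) {x : ℝ} (hx : x ≠ 0) :
    (gammaPDF a r ⋆ₗ[volume] gammaPDF b r) x = gammaPDF (a + b) r x := by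
  simp only [lconvolution_def, neg_add_eq_sub]
  rcases hx.lt_or_gt with hx | hx
  · rw [gammaPDF_of_neg hx, lintegral_eq_zero_of_ae_eq_zero]
    refine .of_forall fun y => ?_
    rcases lt_or_ge y 0 with hy | hy
    · simp only [gammaPDF_of_neg hy, zero_mul, Pi.zero_apply]
    · simp only [gammaPDF_of_neg (show x - y < 0 by linarith), mul_zero, Pi.zero_apply]
  have hae : ∀ᵐ y, y ≠ 0 ∧ y ≠ x := (Measure.ae_ne volume 0).and (Measure.ae_ne volume x)
  have hbeta := setLIntegral_preimage_mul_add hx.ne' 0 univ (betaPDF a b)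
  simp only [preimage_univ, Measure.restrict_univ, sub_zero, lintegral_betaPDF_eq_one ha hb]
    at hbeta
  rw [lintegral_congr_ae (hae.mono fun y hy => gammaPDF_mul_gammaPDF_sub ha hb hr hx hy.1 hy.2),
    lintegral_const_mul' (gammaPDF (a + b) r x) _ ENNReal.ofReal_ne_top,
    lintegral_const_mul' _ _ ENNReal.ofReal_ne_top, ← hbeta, mul_one]

theorem gammaMeasure_conv_gammaMeasure (ha : 0 < a) (hb : 0 < b) (hr : 0 < r) :
    gammaMeasure a r ∗ gammaMeasure b r = gammaMeasure (a + b) r := by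
  have hmeas (a : ℝ) : Measurable (gammaPDF a r) := (measurable_gammaPDFReal a r).ennreal_ofReal
  rw [gammaMeasure, gammaMeasure, gammaMeasure,
    conv_withDensity_eq_lconvolution (hmeas a) (hmeas b)]
  exact withDensity_congr_ae ((Measure.ae_ne volume 0).mono fun x hx =>
    lconvolution_gammaPDF ha hb hr hx)

end Gamma

section ExponentialSums

variable {Ω ι : Type*} [MeasurableSpace Ω] {P : Measure Ω}

theorem measure_mem_and_prodMk_mem_eq_setLIntegral [IsFiniteMeasure P] {α β : Type*}
    [MeasurableSpace α] [MeasurableSpace β] {X : Ω → α} {Y : Ω → β} (hXY : IndepFun X Y P)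
    (hX : Measurable X) (hY : Measurable Y) {C : Set α} (hC : MeasurableSet C) {A : Set (α × β)}
    (hA : MeasurableSet A) :
    P {ω | X ω ∈ C ∧ (X ω, Y ω) ∈ A} = ∫⁻ x in C, P {ω | (x, Y ω) ∈ A} ∂(P.map X) := by
  have hCA : MeasurableSet (Prod.fst ⁻¹' C ∩ A) := (measurable_fst hC).inter hA
  calc P {ω | X ω ∈ C ∧ (X ω, Y ω) ∈ A}
      = P.map (fun ω => (X ω, Y ω)) (Prod.fst ⁻¹' C ∩ A) :=
        (Measure.map_apply (hX.prodMk hY) hCA).symm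
    _ = ∫⁻ x, P.map Y (Prod.mk x ⁻¹' (Prod.fst ⁻¹' C ∩ A)) ∂(P.map X) := by
        rw [hXY.map_prod_eq_prod_map_map hX.aemeasurable hY.aemeasurable, Measure.prod_apply hCA]
    _ = ∫⁻ x, C.indicator (fun x => P {ω | (x, Y ω) ∈ A}) x ∂(P.map X) := by
        refine lintegral_congr fun x => ?_
        rw [Measure.map_apply hY (measurable_prodMk_left hCA)]
        by_cases hx : x ∈ C <;> simp [hx, preimage]
    _ = ∫⁻ x in C, P {ω | (x, Y ω) ∈ A} ∂(P.map X) := lintegral_indicator hC _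

theorem indepFun_sum_prodMk_sum {X : ι → Ω → ℝ} (hindep : iIndepFun X P)
    (hmeas : ∀ i, Measurable (X i)) {s u : Finset ι} {j : ι} (hsu : Disjoint s u) (hj : j ∉ s) :
    IndepFun (fun ω => ∑ i ∈ s, X i ω) (fun ω => (∑ i ∈ u, X i ω, X j ω)) P := by
  classical
  have hdisj : Disjoint s (insert j u) := Finset.disjoint_insert_right.2 ⟨hj, hsu⟩
  convert (hindep.indepFun_finset s (insert j u) hdisj hmeas).comp
    (φ := fun v => ∑ i, v i)
    (ψ := fun v =>
      (∑ i : u, v ⟨i, Finset.mem_insert_of_mem i.2⟩, v ⟨j, Finset.mem_insert_self j u⟩))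
    (by fun_prop) (by fun_prop) using 1
  · exact funext fun ω => (Finset.sum_coe_sort s fun i => X i ω).symm
  · exact funext fun ω => Prod.ext (Finset.sum_coe_sort u fun i => X i ω).symm rfl

theorem map_sum_eq_gammaMeasure {a : ι → ℝ} {r : ℝ} (ha : ∀ i, 0 < a i) (hr : 0 < r)
    {X : ι → Ω → ℝ} (hindep : iIndepFun X P) (hmeas : ∀ i, Measurable (X i))
    (hlaw : ∀ i, P.map (X i) = gammaMeasure (a i) r) {s : Finset ι} (hs : s.Nonempty) :
    P.map (fun ω => ∑ i ∈ s, X i ω) = gammaMeasure (∑ i ∈ s, a i) r := by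
  have := hindep.isProbabilityMeasure
  induction hs using Finset.Nonempty.cons_induction with
  | singleton i => simpa only [Finset.sum_singleton] using hlaw i
  | cons i s hi hs ih =>
    have hind : IndepFun (fun ω => ∑ j ∈ s, X j ω) (X i) P := by
      simpa only [Finset.sum_fn] using hindep.indepFun_finsetSum_of_notMem hmeas hi
    have hconv := hind.map_add_eq_map_conv_map (by fun_prop) (hmeas i)
    rw [ih, hlaw, gammaMeasure_conv_gammaMeasure (Finset.sum_pos (fun j _ => ha j) hs) (ha i) hr]
      at hconv
    simpa only [Finset.sum_cons, add_comm, Pi.add_def] using hconv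

theorem gammaPDF_natCast_add_one (m : ℕ) (r : ℝ) {x : ℝ} (hx : 0 ≤ x) :
    gammaPDF (m + 1) r x =
      ENNReal.ofReal (r ^ (m + 1) * (x ^ m / m.factorial) * Real.exp (-(r * x))) := by
  rw [gammaPDF_of_nonneg hx, Real.Gamma_nat_eq_factorial, add_sub_cancel_right, Real.rpow_natCast,
    ← Nat.cast_succ, Real.rpow_natCast, div_mul_eq_mul_div, mul_div_assoc]

theorem expMeasure_Ioi {r x : ℝ} (hr : 0 < r) (hx : 0 ≤ x) :
    expMeasure r (Ioi x) = ENNReal.ofReal (Real.exp (-(r * x))) := by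
  have := isProbabilityMeasure_expMeasure hr
  rw [← compl_Iic, ← ofReal_measureReal, probReal_compl_eq_one_sub measurableSet_Iic, ← cdf_eq_real,
    cdf_expMeasure_eq hr, if_pos hx, sub_sub_cancel]

theorem ae_expMeasure_pos {r : ℝ} (hr : 0 < r) : ∀ᵐ x ∂expMeasure r, 0 < x := by
  have := isProbabilityMeasure_expMeasure hr
  refine (mem_ae_iff_prob_eq_one measurableSet_Ioi).2 ?_
  rw [expMeasure_Ioi hr le_rfl, mul_zero, neg_zero, Real.exp_zero, ENNReal.ofReal_one]

theorem measure_lt_of_map_eq_expMeasure {r x : ℝ} (hr : 0 < r) {X : Ω → ℝ} (hX : Measurable X)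
    (hlaw : P.map X = expMeasure r) (hx : 0 ≤ x) :
    P {ω | x < X ω} = ENNReal.ofReal (Real.exp (-(r * x))) := by
  rw [← expMeasure_Ioi hr hx, ← hlaw, Measure.map_apply hX measurableSet_Ioi]
  rfl

theorem lintegral_Icc_pow_div_factorial {r : ℝ} (hr : 0 ≤ r) (m : ℕ) :
    ∫⁻ x in Icc 0 r, ENNReal.ofReal (x ^ m / m.factorial) =
      ENNReal.ofReal (r ^ (m + 1) / (m + 1).factorial) := by
  rw [← ofReal_integral_eq_lintegral_ofReal, integral_Icc_eq_integral_Ioc,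
    ← intervalIntegral.integral_of_le hr, intervalIntegral.integral_div, integral_pow,
    Nat.factorial_succ]
  · congr 1
    push_cast
    field_simp
    simp only [zero_pow m.succ_ne_zero, sub_zero]
  · exact Continuous.integrableOn_Icc (by fun_prop)
  · filter_upwards [ae_restrict_mem measurableSet_Icc] with x hx
    exact div_nonneg (pow_nonneg hx.1 m) (Nat.cast_nonneg _)

variable {lam t : ℝ} {τ : ι → Ω → ℝ} {s u : Finset ι} {j : ι}

theorem map_sum_exponential_eq_gammaMeasure (hlam : 0 < lam) (hindep : iIndepFun τ P)
    (hmeas : ∀ i, Measurable (τ i)) (hlaw : ∀ i, P.map (τ i) = expMeasure lam) {m : ℕ}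
    (hs : s.card = m + 1) :
    P.map (fun ω => ∑ i ∈ s, τ i ω) = gammaMeasure (m + 1) lam := by
  have hne : s.Nonempty := Finset.card_pos.1 (hs.trans_gt m.succ_pos)
  rw [map_sum_eq_gammaMeasure (fun _ => one_pos) hlam hindep hmeas hlaw hne, Finset.sum_const, hs,
    nsmul_one, Nat.cast_succ]

theorem measure_sum_mem_and_mem_Ico_eq_setLIntegral (hlam : 0 < lam) (hindep : iIndepFun τ P)
    (hmeas : ∀ i, Measurable (τ i)) (hlaw : ∀ i, P.map (τ i) = expMeasure lam) {m : ℕ}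
    (hs : s.card = m + 1) (hsu : Disjoint s u) (hj : j ∉ s) {C : Set ℝ} (hC : MeasurableSet C)
    (hC₀ : C ⊆ Ici 0) (t : ℝ) :
    P {ω | ∑ i ∈ s, τ i ω ∈ C ∧
        t - ∑ i ∈ s, τ i ω ∈ Ico (∑ i ∈ u, τ i ω) (∑ i ∈ u, τ i ω + τ j ω)} =
      ∫⁻ w in C, ENNReal.ofReal (lam ^ (m + 1) * (w ^ m / m.factorial) * Real.exp (-(lam * w))) *
        P {ω | t - w ∈ Ico (∑ i ∈ u, τ i ω) (∑ i ∈ u, τ i ω + τ j ω)} := by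
  have := hindep.isProbabilityMeasure
  have hA : MeasurableSet {x : ℝ × ℝ × ℝ | t - x.1 ∈ Ico x.2.1 (x.2.1 + x.2.2)} :=
    (measurableSet_le (f := fun x : ℝ × ℝ × ℝ => x.2.1) (by fun_prop)
      (g := fun x => t - x.1) (by fun_prop)).inter
    (measurableSet_lt (f := fun x : ℝ × ℝ × ℝ => t - x.1) (by fun_prop)
      (g := fun x => x.2.1 + x.2.2) (by fun_prop))
  refine (measure_mem_and_prodMk_mem_eq_setLIntegral (indepFun_sum_prodMk_sum hindep hmeas hsu hj)
    (by fun_prop) (by fun_prop) hC hA).trans ?_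
  rw [map_sum_exponential_eq_gammaMeasure hlam hindep hmeas hlaw hs, gammaMeasure,
    setLIntegral_withDensity_eq_setLIntegral_mul_non_measurable (f := gammaPDF (m + 1) lam) _
      (measurable_gammaPDFReal _ _).ennreal_ofReal _ hC (.of_forall fun _ => ENNReal.ofReal_lt_top)]
  refine setLIntegral_congr_fun hC fun w hw => ?_
  rw [Pi.mul_apply, gammaPDF_natCast_add_one m lam (hC₀ hw)]
  rfl

theorem measure_mem_Ico_sum_eq_poisson (hlam : 0 < lam) (hindep : iIndepFun τ P)
    (hmeas : ∀ i, Measurable (τ i)) (hlaw : ∀ i, P.map (τ i) = expMeasure lam) (hj : j ∉ s)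
    (ht : 0 ≤ t) :
    P {ω | t ∈ Ico (∑ i ∈ s, τ i ω) (∑ i ∈ s, τ i ω + τ j ω)} =
      ENNReal.ofReal (Real.exp (-(lam * t)) * (lam * t) ^ s.card / s.card.factorial) := by
  have htail {x : ℝ} (hx : 0 ≤ x) := measure_lt_of_map_eq_expMeasure hlam (hmeas j) (hlaw j) hx
  rcases hcard : s.card with _ | m
  · obtain rfl := Finset.card_eq_zero.1 hcard
    simpa [ht] using htail ht
  have hnonneg : ∀ᵐ ω ∂P, 0 ≤ ∑ i ∈ s, τ i ω := by
    filter_upwards [(Finset.eventually_all s).2 fun i _ =>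
      ae_of_ae_map (hmeas i).aemeasurable (hlaw i ▸ ae_expMeasure_pos hlam)] with ω hω
      using Finset.sum_nonneg fun i hi => (hω i hi).le
  calc P {ω | t ∈ Ico (∑ i ∈ s, τ i ω) (∑ i ∈ s, τ i ω + τ j ω)}
      = P {ω | ∑ i ∈ s, τ i ω ∈ Icc 0 t ∧
          t - ∑ i ∈ s, τ i ω ∈ Ico (∑ i ∈ ∅, τ i ω) (∑ i ∈ ∅, τ i ω + τ j ω)} := by
        refine measure_congr (Filter.eventuallyEq_set.2 (hnonneg.mono fun ω hω => ?_))
        simp only [mem_ofPred_eq, Finset.sum_empty, zero_add, mem_Icc, mem_Ico, sub_nonneg,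
          sub_lt_iff_lt_add', hω, true_and, and_self_left]
    _ = ∫⁻ w in Icc 0 t,
          ENNReal.ofReal (lam ^ (m + 1) * (w ^ m / m.factorial) * Real.exp (-(lam * w))) *
            P {ω | t - w ∈ Ico (∑ i ∈ ∅, τ i ω) (∑ i ∈ ∅, τ i ω + τ j ω)} :=
        measure_sum_mem_and_mem_Ico_eq_setLIntegral hlam hindep hmeas hlaw hcard
          (Finset.disjoint_empty_right s) hj measurableSet_Icc Icc_subset_Ici_self t
    _ = ∫⁻ w in Icc 0 t, ENNReal.ofReal (lam ^ (m + 1) * Real.exp (-(lam * t))) *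
          ENNReal.ofReal (w ^ m / m.factorial) := by
        refine setLIntegral_congr_fun measurableSet_Icc fun w hw => ?_
        have hsub : 0 ≤ t - w := sub_nonneg.2 hw.2
        have hexp :
            Real.exp (-(lam * t)) = Real.exp (-(lam * w)) * Real.exp (-(lam * (t - w))) := by
          rw [← Real.exp_add]
          ring_nf
        simp only [Finset.sum_empty, zero_add, mem_Ico, hsub, true_and, htail hsub]
        rw [← ENNReal.ofReal_mul' (by positivity), ← ENNReal.ofReal_mul (by positivity), hexp]
        ring_nf
    _ = ENNReal.ofReal (Real.exp (-(lam * t)) * (lam * t) ^ (m + 1) / (m + 1).factorial) := by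
        rw [lintegral_const_mul' _ _ ENNReal.ofReal_ne_top, lintegral_Icc_pow_div_factorial ht,
          ← ENNReal.ofReal_mul (by positivity), mul_pow]
        ring_nf

end ExponentialSums

section Independence

variable {Ω ι : Type*} [MeasurableSpace Ω] {P : Measure Ω}

theorem ae_mem_of_sum_measure_singleton [IsProbabilityMeasure P] {α : Type*} [MeasurableSpace α]
    [MeasurableSingletonClass α] {X : Ω → α} (hX : Measurable X) {s : Finset α}
    (hs : ∑ a ∈ s, P {ω | X ω = a} = 1) : ∀ᵐ ω ∂P, X ω ∈ s := by
  refine (mem_ae_iff_prob_eq_one (hX s.measurableSet)).2 ?_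
  rw [← sum_measure_preimage_singleton s fun a _ => hX (measurableSet_singleton a)]
  exact hs

theorem ae_sum_mul_ne {X : ι → Ω → ℝ} (hindep : iIndepFun X P) (hmeas : ∀ i, Measurable (X i))
    (hatom : ∀ i x, P {ω | X i ω = x} = 0) {s : Finset ι} {i : ι} (hi : i ∈ s) {a : ι → ℝ}
    (ha : a i ≠ 0) (b : ℝ) : ∀ᵐ ω ∂P, ∑ j ∈ s, a j * X j ω ≠ b := by
  classical
  have := hindep.isProbabilityMeasure
  have hind : IndepFun (fun ω => ∑ j ∈ s.erase i, a j * X j ω) (fun ω => a i * X i ω) P := by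
    simpa only [Finset.sum_fn, Function.comp_def] using
      (hindep.comp (fun j x => a j * x) fun j => measurable_const_mul (a j))
        |>.indepFun_finsetSum_of_notMem (fun j => (hmeas j).const_mul (a j)) (s.notMem_erase i)
  have hnull := measure_mem_and_prodMk_mem_eq_setLIntegral hind (by fun_prop) (by fun_prop)
    MeasurableSet.univ (A := {x : ℝ × ℝ | x.1 + x.2 = b})
    (measurableSet_eq_fun (by fun_prop) (by fun_prop))
  have hsection (x : ℝ) : P {ω | x + a i * X i ω = b} = 0 := by
    simpa only [add_comm x, ← eq_sub_iff_add_eq, eq_div_iff ha, mul_comm (a i)]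
      using hatom i ((b - x) / a i)
  simp only [mem_univ, true_and, mem_ofPred_eq, hsection, lintegral_zero,
    Finset.sum_erase_add _ _ hi] at hnull
  exact ae_iff.2 (by simpa only [ne_eq, not_not] using hnull)

theorem ae_linearIndependent_int {X : ι → Ω → ℝ} [Countable ι] (hindep : iIndepFun X P)
    (hmeas : ∀ i, Measurable (X i)) (hatom : ∀ i x, P {ω | X i ω = x} = 0) {t : ℝ} (ht : t ≠ 0) :
    ∀ᵐ ω ∂P, LinearIndependent ℤ fun o : Option ι => o.elim t (X · ω) := by
  simp only [linearIndependent_iff, Finsupp.linearCombination_option]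
  refine ae_all_iff.2 fun l => ?_
  rcases eq_or_ne l.some 0 with hl | hl
  · refine .of_forall fun ω h => Finsupp.ext fun o => ?_
    cases o with
    | none => simpa [hl, ht] using h
    | some i => exact DFunLike.congr_fun hl i
  · obtain ⟨i, hi⟩ := Finsupp.support_nonempty_iff.2 hl
    filter_upwards [ae_sum_mul_ne hindep hmeas hatom hi (a := fun j => (l.some j : ℝ))
      (Int.cast_ne_zero.2 (Finsupp.mem_support_iff.1 hi)) (-(l none * t))] with ω hω h
    refine absurd ?_ hω
    rw [Finsupp.linearCombination_apply, Finsupp.sum] at h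
    simp only [zsmul_eq_mul, Function.comp_apply, Option.elim_some, Option.elim_none] at h
    linarith

end Independence

namespace PlanarMotion

section FlightLaw

variable {Ω ι : Type*} [MeasurableSpace Ω] {P : Measure Ω} {lam t : ℝ} {τ : ι → Ω → ℝ}
  {s u : Finset ι} {j : ι}

theorem measure_sum_mem_and_mem_Ico_eq_setLIntegral_flightDensity (hlam : 0 < lam)
    (hindep : iIndepFun τ P) (hmeas : ∀ i, Measurable (τ i))
    (hlaw : ∀ i, P.map (τ i) = expMeasure lam) {a b : ℕ} (hs : s.card = a + 1) (hu : u.card = b)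
    (hsu : Disjoint s u) (hjs : j ∉ s) (hju : j ∉ u) {C : Set ℝ} (hC : MeasurableSet C)
    (hCt : C ⊆ Icc 0 t) :
    P {ω | ∑ i ∈ s, τ i ω ∈ C ∧
        t - ∑ i ∈ s, τ i ω ∈ Ico (∑ i ∈ u, τ i ω) (∑ i ∈ u, τ i ω + τ j ω)} =
      ∫⁻ w in C, ENNReal.ofReal (flightDensity lam t a b w) := by
  rw [measure_sum_mem_and_mem_Ico_eq_setLIntegral hlam hindep hmeas hlaw hs hsu hjs hC
    (hCt.trans Icc_subset_Ici_self)]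
  refine setLIntegral_congr_fun hC fun w hw => ?_
  have hw₀ : 0 ≤ w := (hCt hw).1
  have hexp : Real.exp (-lam * t) = Real.exp (-(lam * w)) * Real.exp (-(lam * (t - w))) := by
    rw [← Real.exp_add]
    ring_nf
  rw [measure_mem_Ico_sum_eq_poisson hlam hindep hmeas hlaw hju (sub_nonneg.2 (hCt hw).2), hu,
    ← ENNReal.ofReal_mul (by positivity), flightDensity, hexp, mul_pow]
  ring_nf

end FlightLaw

variable {Ω : Type*} {τ : ℕ → Ω → ℝ} {J₀ : Ω → ℤ} {ξ : ℕ → Ω → ℤ} {ω : Ω} {n : ℕ} {t : ℝ}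

section Path

theorem arrival_zero : arrival τ 0 ω = 0 :=
  Finset.sum_range_zero _

theorem arrival_succ (n : ℕ) : arrival τ (n + 1) ω = arrival τ n ω + τ n ω :=
  Finset.sum_range_succ _ _

theorem strictMono_arrival (hpos : ∀ i, 0 < τ i ω) : StrictMono fun n => arrival τ n ω :=
  strictMono_nat_of_lt_succ fun n => by
    rw [arrival_succ]
    exact lt_add_of_pos_right _ (hpos n)

theorem count_eq (hpos : ∀ i, 0 < τ i ω) (ht : t ∈ Ico (arrival τ n ω) (arrival τ (n + 1) ω)) :
    count τ t ω = n := by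
  have hset : {m : ℕ | 1 ≤ m ∧ arrival τ m ω ≤ t} = Finset.Icc 1 n := by
    ext m
    simp only [mem_ofPred_eq, Finset.coe_Icc, mem_Icc, and_congr_right_iff]
    refine fun _ => ⟨fun hm => ?_, fun hm => ?_⟩
    · exact Nat.lt_succ_iff.1 ((strictMono_arrival hpos).lt_iff_lt.1 (hm.trans_lt ht.2))
    · exact ((strictMono_arrival hpos).monotone hm).trans ht.1
  rw [count, hset, ncard_coe_finset, Nat.card_Icc, Nat.add_sub_cancel]

/-- The index of the direction of the `m`-th flight, that is, after the first `m` turns. -/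
def turnIndex (J₀ : Ω → ℤ) (ξ : ℕ → Ω → ℤ) (m : ℕ) (ω : Ω) : ℤ :=
  J₀ ω + ∑ k ∈ Finset.range m, ξ k ω

theorem dirIndex_eq_turnIndex (hpos : ∀ i, 0 < τ i ω)
    (ht : t ∈ Ico (arrival τ n ω) (arrival τ (n + 1) ω)) :
    dirIndex J₀ τ ξ t ω = turnIndex J₀ ξ n ω := by
  rw [dirIndex, count_eq hpos ht, turnIndex]

theorem eqOn_comp_dirIndex (hpos : ∀ i, 0 < τ i ω)
    (ht : t ∈ Icc (arrival τ n ω) (arrival τ (n + 1) ω)) (f : ℤ → ℝ) :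
    EqOn (fun _ => f (turnIndex J₀ ξ n ω)) (fun s => f (dirIndex J₀ τ ξ s ω))
      (uIoo (arrival τ n ω) t) := by
  intro s hs
  rw [uIoo_of_le ht.1] at hs
  exact congrArg f (dirIndex_eq_turnIndex hpos ⟨hs.1.le, hs.2.trans_le ht.2⟩).symm

theorem intervalIntegrable_comp_dirIndex (hpos : ∀ i, 0 < τ i ω)
    (ht : t ∈ Icc (arrival τ n ω) (arrival τ (n + 1) ω)) (f : ℤ → ℝ) :
    IntervalIntegrable (fun s => f (dirIndex J₀ τ ξ s ω)) volume (arrival τ n ω) t :=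
  intervalIntegrable_const.congr_uIoo (eqOn_comp_dirIndex hpos ht f)

theorem integral_comp_dirIndex_of_mem_Icc (hpos : ∀ i, 0 < τ i ω)
    (ht : t ∈ Icc (arrival τ n ω) (arrival τ (n + 1) ω)) (f : ℤ → ℝ) :
    ∫ s in arrival τ n ω..t, f (dirIndex J₀ τ ξ s ω) =
      (t - arrival τ n ω) * f (turnIndex J₀ ξ n ω) := by
  rw [← intervalIntegral.integral_congr_uIoo (eqOn_comp_dirIndex hpos ht f),
    intervalIntegral.integral_const, smul_eq_mul]

theorem integral_comp_dirIndex (hpos : ∀ i, 0 < τ i ω)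
    (ht : t ∈ Ico (arrival τ n ω) (arrival τ (n + 1) ω)) (f : ℤ → ℝ) :
    ∫ s in (0 : ℝ)..t, f (dirIndex J₀ τ ξ s ω) =
      ∑ m ∈ Finset.range n, τ m ω * f (turnIndex J₀ ξ m ω) +
        (t - ∑ m ∈ Finset.range n, τ m ω) * f (turnIndex J₀ ξ n ω) := by
  have hflight (m : ℕ) : arrival τ (m + 1) ω ∈ Icc (arrival τ m ω) (arrival τ (m + 1) ω) :=
    right_mem_Icc.2 ((strictMono_arrival hpos).monotone m.le_succ)
  have hint (m : ℕ) := intervalIntegrable_comp_dirIndex (J₀ := J₀) (ξ := ξ) hpos (hflight m) f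
  rw [← arrival_zero (τ := τ) (ω := ω), ← intervalIntegral.integral_add_adjacent_intervals
      (IntervalIntegrable.trans_iterate fun m _ => hint m)
      (intervalIntegrable_comp_dirIndex hpos (Ico_subset_Icc_self ht) f),
    integral_comp_dirIndex_of_mem_Icc hpos (Ico_subset_Icc_self ht),
    ← intervalIntegral.sum_integral_adjacent_intervals fun m _ => hint m]
  simp only [integral_comp_dirIndex_of_mem_Icc hpos (hflight _)]
  simp only [arrival_succ, add_sub_cancel_left]
  rfl

end Path

section HorizontalPath

theorem exists_sin_eq_intCast (j : ℤ) :
    ∃ e : ℤ, Real.sin (Real.pi / 2 * j) = e ∧ (e = 0 ↔ Even j) := by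
  rcases Int.even_or_odd' j with ⟨k, rfl | rfl⟩
  · have harg : Real.pi / 2 * ((2 * k : ℤ) : ℝ) = k * Real.pi := by push_cast; ring
    exact ⟨0, by rw [harg, Real.sin_int_mul_pi, Int.cast_zero], by simp⟩
  · have harg : Real.pi / 2 * ((2 * k + 1 : ℤ) : ℝ) = k * Real.pi + Real.pi / 2 := by
      push_cast; ring
    rw [harg, Real.sin_add_pi_div_two, Real.cos_int_mul_pi]
    rcases Int.even_or_odd k with hk | hk
    · exact ⟨1, by simp [hk.neg_one_zpow], by simp⟩
    · exact ⟨-1, by simp [hk.neg_one_zpow], by simp⟩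

theorem sum_mul_add_sub_sum_mul_eq_zero_iff {v : ℕ → ℝ}
    (hv : LinearIndependent ℤ fun o : Option ℕ => o.elim t v) (e : ℕ → ℤ) (n : ℕ) :
    ∑ m ∈ Finset.range n, v m * e m + (t - ∑ m ∈ Finset.range n, v m) * e n = 0 ↔
      ∀ m ≤ n, e m = 0 := by
  constructor
  · intro h
    have hcoeff := linearIndependent_iff'.1 hv (Finset.range n).insertNone
      (fun o => o.elim (e n) fun m => e m - e n) (by
        simp only [Finset.sum_insertNone, Option.elim_none, Option.elim_some, zsmul_eq_mul,
          Int.cast_sub, sub_mul, Finset.sum_sub_distrib, ← Finset.mul_sum]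
        rw [← h]
        simp only [mul_comm (v _)]
        ring)
    have hn : e n = 0 := hcoeff none (Finset.none_mem_insertNone)
    intro m hm
    rcases hm.lt_or_eq with hm | rfl
    · have := hcoeff (some m) (Finset.some_mem_insertNone.2 (Finset.mem_range.2 hm))
      rwa [Option.elim_some, hn, sub_zero] at this
    · exact hn
  · intro h
    rw [h n le_rfl, Int.cast_zero, mul_zero, add_zero]
    exact Finset.sum_eq_zero fun m hm => by
      rw [h m (Finset.mem_range.1 hm).le, Int.cast_zero, mul_zero]

theorem posY_eq_zero_iff_forall_even {c : ℝ} (hc : c ≠ 0) (hpos : ∀ i, 0 < τ i ω)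
    (ht : t ∈ Ico (arrival τ n ω) (arrival τ (n + 1) ω))
    (hli : LinearIndependent ℤ fun o : Option ℕ => o.elim t (τ · ω)) :
    posY c J₀ τ ξ t ω = 0 ↔ ∀ m ≤ n, Even (turnIndex J₀ ξ m ω) := by
  choose e he he₀ using exists_sin_eq_intCast
  simp only [posY, he, intervalIntegral.integral_const_mul, mul_eq_zero, hc, false_or, ← he₀]
  rw [integral_comp_dirIndex hpos ht fun j => (e j : ℝ)]
  exact sum_mul_add_sub_sum_mul_eq_zero_iff hli (fun m => e (turnIndex J₀ ξ m ω)) n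

theorem forall_even_turnIndex_iff :
    (∀ m ≤ n, Even (turnIndex J₀ ξ m ω)) ↔ Even (J₀ ω) ∧ ∀ m < n, Even (ξ m ω) := by
  have hzero : turnIndex J₀ ξ 0 ω = J₀ ω := by simp [turnIndex]
  have hsucc (m : ℕ) : turnIndex J₀ ξ (m + 1) ω = turnIndex J₀ ξ m ω + ξ m ω := by
    simp only [turnIndex, Finset.sum_range_succ, add_assoc]
  constructor
  · refine fun h => ⟨hzero ▸ h 0 n.zero_le, fun m hm => ?_⟩
    have := h (m + 1) hm
    rw [hsucc, Int.even_add] at this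
    exact this.1 (h m hm.le)
  · rintro ⟨hJ, hξ⟩ m
    induction m with
    | zero => exact fun _ => hzero ▸ hJ
    | succ m ih => exact fun hm => hsucc m ▸ (ih (Nat.le_of_succ_le hm)).add (hξ m hm)

end HorizontalPath

section Reflections

/-- The indices of the flights before the `n`-th one that have the parity of `n`: if all turns are
reflections, these flights go in the direction of the `n`-th one. -/
def inPhase (n : ℕ) : Finset ℕ := {i ∈ Finset.range n | Even (n + i)}

/-- The indices of the flights before the `n`-th one that have the parity opposite to `n`: if all
turns are reflections, these flights go against the direction of the `n`-th one. -/
def offPhase (n : ℕ) : Finset ℕ := {i ∈ Finset.range n | ¬ Even (n + i)}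

theorem disjoint_offPhase_inPhase (n : ℕ) : Disjoint (offPhase n) (inPhase n) :=
  (Finset.disjoint_filter_filter_not _ _ _).symm

theorem notMem_inPhase (n : ℕ) : n ∉ inPhase n := by simp [inPhase]

theorem notMem_offPhase (n : ℕ) : n ∉ offPhase n := by simp [offPhase]

theorem inPhase_succ (n : ℕ) : inPhase (n + 1) = offPhase n := by
  ext i
  simp only [inPhase, offPhase, Finset.mem_filter, Finset.mem_range, Nat.even_iff]
  omega

theorem offPhase_succ (n : ℕ) : offPhase (n + 1) = insert n (inPhase n) := by
  ext i
  simp only [inPhase, offPhase, Finset.mem_filter, Finset.mem_range, Finset.mem_insert,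
    Nat.even_iff]
  omega

theorem card_inPhase_and_card_offPhase (n : ℕ) :
    (inPhase n).card = n / 2 ∧ (offPhase n).card = (n + 1) / 2 := by
  induction n with
  | zero => exact ⟨rfl, rfl⟩
  | succ n ih =>
    rw [inPhase_succ, offPhase_succ, Finset.card_insert_of_notMem (notMem_inPhase n), ih.1, ih.2]
    omega

theorem sum_inPhase_add_sum_offPhase (f : ℕ → ℝ) (n : ℕ) :
    ∑ i ∈ inPhase n, f i + ∑ i ∈ offPhase n, f i = ∑ i ∈ Finset.range n, f i :=
  Finset.sum_filter_add_sum_filter_not _ _ _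

theorem sum_mul_neg_one_pow (f : ℕ → ℝ) (n : ℕ) :
    ∑ i ∈ Finset.range n, f i * (-1) ^ i =
      (-1) ^ n * (∑ i ∈ inPhase n, f i - ∑ i ∈ offPhase n, f i) := by
  induction n with
  | zero => simp [inPhase, offPhase]
  | succ n ih =>
    rw [Finset.sum_range_succ, ih, inPhase_succ, offPhase_succ,
      Finset.sum_insert (notMem_inPhase n), pow_succ]
    ring

theorem turnIndex_eq {j : ℕ} (hJ : J₀ ω = 2 * j) (hξ : ∀ m < n, ξ m ω = 2) {m : ℕ} (hm : m ≤ n) :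
    turnIndex J₀ ξ m ω = 2 * (j + m : ℕ) := by
  rw [turnIndex, hJ, Finset.sum_congr rfl fun k hk => hξ k ((Finset.mem_range.1 hk).trans_le hm),
    Finset.sum_const, Finset.card_range, nsmul_eq_mul]
  push_cast
  ring

theorem cos_turnIndex {j : ℕ} (hJ : J₀ ω = 2 * j) (hξ : ∀ m < n, ξ m ω = 2) {m : ℕ}
    (hm : m ≤ n) : Real.cos (Real.pi / 2 * turnIndex J₀ ξ m ω) = (-1) ^ j * (-1) ^ m := by
  rw [turnIndex_eq hJ hξ hm, ← pow_add, ← Real.cos_nat_mul_pi]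
  push_cast
  ring_nf

theorem posX_eq (c : ℝ) (hpos : ∀ i, 0 < τ i ω)
    (ht : t ∈ Ico (arrival τ n ω) (arrival τ (n + 1) ω)) {j : ℕ} (hJ : J₀ ω = 2 * j)
    (hξ : ∀ m < n, ξ m ω = 2) :
    posX c J₀ τ ξ t ω = (-1) ^ (j + n) * c * (t - 2 * ∑ i ∈ offPhase n, τ i ω) := by
  have hsum : ∑ m ∈ Finset.range n, τ m ω * Real.cos (Real.pi / 2 * turnIndex J₀ ξ m ω) =
      (-1) ^ j * ∑ m ∈ Finset.range n, τ m ω * (-1) ^ m := by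
    rw [Finset.mul_sum]
    refine Finset.sum_congr rfl fun m hm => ?_
    rw [cos_turnIndex hJ hξ (Finset.mem_range.1 hm).le]
    ring
  rw [posX, intervalIntegral.integral_const_mul,
    integral_comp_dirIndex hpos ht fun j => Real.cos (Real.pi / 2 * j), hsum,
    cos_turnIndex hJ hξ le_rfl, sum_mul_neg_one_pow (τ · ω), ← sum_inPhase_add_sum_offPhase]
  ring

end Reflections

variable {c : ℝ} {B : Set ℝ}

section ReflectionEvent

/-- The durations `w` for which the point `ε c (t - 2 w)`, reached at time `t` by a particle of
speed `c` that spends the duration `w` in the direction `-ε` and the rest of the time in the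
direction `ε`, lies in `B`. -/
def durations (c t ε : ℝ) (B : Set ℝ) : Set ℝ := {w | ε * c * (t - 2 * w) ∈ B}

theorem measurableSet_durations (hB : MeasurableSet B) (c t ε : ℝ) :
    MeasurableSet (durations c t ε B) :=
  (show Measurable fun w : ℝ => ε * c * (t - 2 * w) by fun_prop) hB

theorem durations_subset_Ioo {ε : ℝ} (hc : 0 < c) (hε : |ε| = 1)
    (hB : B ⊆ Ioo (-(c * t)) (c * t)) : durations c t ε B ⊆ Ioo 0 t := by
  intro w hw
  have habs : |t - 2 * w| < t := by
    have := abs_lt.2 (hB hw)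
    rwa [abs_mul, abs_mul, hε, abs_of_pos hc, one_mul, mul_lt_mul_iff_right₀ hc] at this
  constructor <;> linarith [abs_lt.1 habs]

theorem setLIntegral_durations {ε : ℝ} (hc : 0 < c) (hε : |ε| = 1) (f : ℝ → ENNReal) :
    ∫⁻ w in durations c t ε B, f w =
      ENNReal.ofReal (1 / (2 * c)) * ∫⁻ x in B, f ((t - ε * x / c) / 2) := by
  have hε₀ : ε ≠ 0 := abs_ne_zero.1 (hε ▸ one_ne_zero)
  have hε₂ : ε ^ 2 = 1 := by rw [← sq_abs, hε, one_pow]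
  have hset : durations c t ε B = (fun w => -2 * ε * c * w + ε * c * t) ⁻¹' B := by
    ext w
    simp only [durations, mem_ofPred_eq, mem_preimage]
    ring_nf
  rw [hset, setLIntegral_preimage_mul_add (by positivity)]
  congr 2
  · rw [abs_inv, abs_mul, abs_mul, hε, abs_of_pos hc, abs_neg, abs_two, mul_one, one_div]
  · ext x
    congr 1
    field_simp
    linear_combination x * hε₂

/-- The interarrival times for which `n` changes of direction occur up to time `t` and the flights
of index in `offPhase n` have a total duration in `C`. -/
def flightTimes (t : ℝ) (n : ℕ) (C : Set ℝ) : Set (ℕ → ℝ) :=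
  {v | ∑ i ∈ offPhase n, v i ∈ C ∧
    t - ∑ i ∈ offPhase n, v i ∈ Ico (∑ i ∈ inPhase n, v i) (∑ i ∈ inPhase n, v i + v n)}

theorem measurableSet_flightTimes {C : Set ℝ} (hC : MeasurableSet C) (t : ℝ) (n : ℕ) :
    MeasurableSet (flightTimes t n C) :=
  (show Measurable fun v : ℕ → ℝ => ∑ i ∈ offPhase n, v i by fun_prop) hC |>.inter <|
    (measurableSet_le (f := fun v : ℕ → ℝ => ∑ i ∈ inPhase n, v i) (by fun_prop)
      (g := fun v => t - ∑ i ∈ offPhase n, v i) (by fun_prop)).inter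
    (measurableSet_lt (f := fun v : ℕ → ℝ => t - ∑ i ∈ offPhase n, v i) (by fun_prop)
      (g := fun v => ∑ i ∈ inPhase n, v i + v n) (by fun_prop))

theorem mem_flightTimes_iff {C : Set ℝ} :
    (fun i => τ i ω) ∈ flightTimes t n C ↔
      ∑ i ∈ offPhase n, τ i ω ∈ C ∧ t ∈ Ico (arrival τ n ω) (arrival τ (n + 1) ω) := by
  simp only [flightTimes, mem_ofPred_eq, mem_Ico, arrival_succ, le_sub_iff_add_le,
    sub_lt_iff_lt_add, add_right_comm _ (τ n ω), sum_inPhase_add_sum_offPhase (τ · ω)]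
  rfl

/-- The event that there are `n` changes of direction up to time `t`, all of them reflections,
that the initial direction is `d_{2j}` and that the abscissa at time `t`, computed from the total
duration of the flights of index in `offPhase n`, lies in `B`. -/
def reflectionEvent (c t : ℝ) (J₀ : Ω → ℤ) (τ : ℕ → Ω → ℝ) (ξ : ℕ → Ω → ℤ) (B : Set ℝ)
    (n j : ℕ) : Set Ω :=
  {ω | J₀ ω = 2 * j ∧
    (fun i => τ i ω) ∈ flightTimes t n (durations c t ((-1) ^ (j + n)) B) ∧ ∀ m < n, ξ m ω = 2}

theorem mem_reflectionEvent_iff (hpos : ∀ i, 0 < τ i ω) {j : ℕ} :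
    ω ∈ reflectionEvent c t J₀ τ ξ B n j ↔ posX c J₀ τ ξ t ω ∈ B ∧
      t ∈ Ico (arrival τ n ω) (arrival τ (n + 1) ω) ∧ J₀ ω = 2 * j ∧ ∀ m < n, ξ m ω = 2 := by
  have hX (hn : t ∈ Ico (arrival τ n ω) (arrival τ (n + 1) ω)) (hJ : J₀ ω = 2 * j)
      (hξ : ∀ m < n, ξ m ω = 2) : ∑ i ∈ offPhase n, τ i ω ∈ durations c t ((-1) ^ (j + n)) B ↔
        posX c J₀ τ ξ t ω ∈ B := by
    rw [posX_eq c hpos hn hJ hξ]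
    rfl
  simp only [reflectionEvent, mem_ofPred_eq, mem_flightTimes_iff]
  grind

theorem reflectionEvent_zero (hc : 0 < c) (hB : B ⊆ Ioo (-(c * t)) (c * t)) (j : ℕ) :
    reflectionEvent c t J₀ τ ξ B 0 j = ∅ := by
  refine eq_empty_of_forall_notMem fun ω hω => ?_
  have hzero : (0 : ℝ) ∈ Ioo 0 t := by
    simpa [offPhase] using durations_subset_Ioo hc (abs_neg_one_pow _) hB hω.2.1.1
  exact lt_irrefl 0 hzero.1

theorem measurableSet_forall_lt_eq_two (n : ℕ) :
    MeasurableSet {v : ℕ → ℤ | ∀ m < n, v m = 2} := by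
  simp only [ofPred_forall]
  exact .iInter fun m => .iInter fun _ => measurable_pi_apply m (measurableSet_singleton 2)

end ReflectionEvent

variable [MeasurableSpace Ω] {P : Measure Ω} {lam p q : ℝ}

section AlmostSure

theorem IsDriving.isProbabilityMeasure (h : IsDriving P lam p q J₀ τ ξ) : IsProbabilityMeasure P :=
  h.indep_time.isProbabilityMeasure

theorem IsDriving.ae_time_pos (h : IsDriving P lam p q J₀ τ ξ) (hlam : 0 < lam) :
    ∀ᵐ ω ∂P, ∀ i, 0 < τ i ω :=
  ae_all_iff.2 fun i => ae_of_ae_map (h.measurable_time i).aemeasurable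
    (h.law_time i ▸ ae_expMeasure_pos hlam)

theorem IsDriving.measure_time_eq (h : IsDriving P lam p q J₀ τ ξ) (i : ℕ) (x : ℝ) :
    P {ω | τ i ω = x} = 0 := by
  have hatom : P.map (τ i) {x} = 0 := by
    rw [h.law_time]
    exact withDensity_absolutelyContinuous _ _ (measure_singleton x)
  rwa [Measure.map_apply (h.measurable_time i) (measurableSet_singleton x)] at hatom

theorem IsDriving.ae_exists_mem_Ico_arrival (h : IsDriving P lam p q J₀ τ ξ) (hlam : 0 < lam)
    (ht : 0 ≤ t) : ∀ᵐ ω ∂P, ∃ n, t ∈ Ico (arrival τ n ω) (arrival τ (n + 1) ω) := by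
  have := h.isProbabilityMeasure
  have harrival (n : ℕ) : Measurable (arrival τ n) :=
    Finset.measurable_sum _ fun i _ => h.measurable_time i
  have hmeas (n : ℕ) : MeasurableSet {ω | t ∈ Ico (arrival τ n ω) (arrival τ (n + 1) ω)} :=
    (measurableSet_le (harrival n) measurable_const).inter
      (measurableSet_lt measurable_const (harrival (n + 1)))
  have hdisj : Pairwise (Function.onFun (AEDisjoint P)
      fun n => {ω | t ∈ Ico (arrival τ n ω) (arrival τ (n + 1) ω)}) := fun n m hnm =>
    measure_mono_null (fun ω hω hpos => hnm ((count_eq hpos hω.1).symm.trans (count_eq hpos hω.2)))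
      (ae_iff.1 (h.ae_time_pos hlam))
  have hpoisson (n : ℕ) : P {ω | t ∈ Ico (arrival τ n ω) (arrival τ (n + 1) ω)} =
      ENNReal.ofReal (Real.exp (-(lam * t)) * (lam * t) ^ n / n.factorial) := by
    simpa only [arrival, Finset.sum_range_succ, Finset.card_range] using
      measure_mem_Ico_sum_eq_poisson hlam h.indep_time h.measurable_time h.law_time
        (Finset.notMem_range_self (n := n)) ht
  have hunion : P (⋃ n, {ω | t ∈ Ico (arrival τ n ω) (arrival τ (n + 1) ω)}) = 1 := by
    have hsum : HasSum (fun n : ℕ => Real.exp (-(lam * t)) * (lam * t) ^ n / n.factorial) 1 :=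
      hasSum_one_poissonMeasure ⟨lam * t, by positivity⟩
    rw [measure_iUnion₀ hdisj fun n => (hmeas n).nullMeasurableSet, tsum_congr hpoisson,
      ← ENNReal.ofReal_tsum_of_nonneg (fun n => by positivity) hsum.summable,
      hsum.tsum_eq, ENNReal.ofReal_one]
  filter_upwards [(mem_ae_iff_prob_eq_one (.iUnion hmeas)).2 hunion] with ω hω
  obtain ⟨n, hn⟩ := mem_iUnion.1 hω
  exact ⟨n, hn⟩

theorem IsDriving.ae_init_mem (h : IsDriving P lam p q J₀ τ ξ) :
    ∀ᵐ ω ∂P, J₀ ω ∈ Finset.Icc (0 : ℤ) 3 := by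
  have := h.isProbabilityMeasure
  refine ae_mem_of_sum_measure_singleton h.measurable_init ?_
  rw [Finset.sum_congr rfl fun j hj =>
    h.law_init j (Finset.mem_Icc.1 hj).1 (Finset.mem_Icc.1 hj).2, Finset.sum_const, nsmul_eq_mul]
  exact ENNReal.mul_div_cancel (by simp) (by simp)

theorem IsDriving.ae_turn_mem (h : IsDriving P lam p q J₀ τ ξ) (hp : 0 ≤ p) (hq : 0 ≤ q)
    (hpq : p + q ≤ 1) : ∀ᵐ ω ∂P, ∀ n, ξ n ω ∈ ({1, -1, 2} : Finset ℤ) := by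
  have := h.isProbabilityMeasure
  refine ae_all_iff.2 fun n => ae_mem_of_sum_measure_singleton (h.measurable_turn n) ?_
  have hr : 0 ≤ 1 - p - q := by linarith
  rw [Finset.sum_insert (by decide), Finset.sum_insert (by decide), Finset.sum_singleton,
    h.law_counterclockwise, h.law_clockwise, h.law_reflection, ← ENNReal.ofReal_add hq hr,
    ← ENNReal.ofReal_add hp (by positivity), add_sub_cancel, add_sub_cancel, ENNReal.ofReal_one]

theorem IsDriving.ae_posY_eq_zero_iff (h : IsDriving P lam p q J₀ τ ξ) (hlam : 0 < lam)
    (hp : 0 ≤ p) (hq : 0 ≤ q) (hpq : p + q ≤ 1) (hc : c ≠ 0) (ht : t ≠ 0) :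
    ∀ᵐ ω ∂P, ∀ n, t ∈ Ico (arrival τ n ω) (arrival τ (n + 1) ω) →
      (posY c J₀ τ ξ t ω = 0 ↔ (∃ j : Fin 2, J₀ ω = 2 * (j : ℕ)) ∧ ∀ m < n, ξ m ω = 2) := by
  have hinit_even : ∀ j ∈ Finset.Icc (0 : ℤ) 3, Even j ↔ ∃ i : Fin 2, j = 2 * (i : ℕ) := by decide
  have hturn_even : ∀ k ∈ ({1, -1, 2} : Finset ℤ), Even k ↔ k = 2 := by decide
  filter_upwards [h.ae_time_pos hlam, h.ae_init_mem, h.ae_turn_mem hp hq hpq,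
    ae_linearIndependent_int h.indep_time h.measurable_time h.measure_time_eq ht]
    with ω hpos hinit hturn hli n hn
  rw [posY_eq_zero_iff_forall_even hc hpos hn hli, forall_even_turnIndex_iff,
    hinit_even _ hinit]
  simp only [hturn_even _ (hturn _)]

end AlmostSure

section Law

theorem IsDriving.measure_flightTimes (h : IsDriving P lam p q J₀ τ ξ) (hlam : 0 < lam)
    {C : Set ℝ} (hC : MeasurableSet C) (hCt : C ⊆ Icc 0 t) (n : ℕ) :
    P {ω | (fun i => τ i ω) ∈ flightTimes t (n + 1) C} =
      ∫⁻ w in C, ENNReal.ofReal (flightDensity lam t (n / 2) ((n + 1) / 2) w) :=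
  measure_sum_mem_and_mem_Ico_eq_setLIntegral_flightDensity hlam h.indep_time h.measurable_time
    h.law_time ((card_inPhase_and_card_offPhase (n + 1)).2.trans (by omega))
    (card_inPhase_and_card_offPhase (n + 1)).1 (disjoint_offPhase_inPhase _) (notMem_offPhase _)
    (notMem_inPhase _) hC hCt

theorem IsDriving.measurableSet_reflectionEvent (h : IsDriving P lam p q J₀ τ ξ) (c t : ℝ)
    (hB : MeasurableSet B) (n j : ℕ) : MeasurableSet (reflectionEvent c t J₀ τ ξ B n j) :=
  (h.measurable_init (measurableSet_singleton _)).inter <|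
    (measurable_pi_lambda _ h.measurable_time
      (measurableSet_flightTimes (measurableSet_durations hB c t _) t n)).inter
    (measurable_pi_lambda _ h.measurable_turn (measurableSet_forall_lt_eq_two n))

theorem IsDriving.measure_init_time_turn (h : IsDriving P lam p q J₀ τ ξ) (j : ℤ)
    {A : Set (ℕ → ℝ)} (hA : MeasurableSet A) {R : Set (ℕ → ℤ)} (hR : MeasurableSet R) :
    P {ω | J₀ ω = j ∧ (fun i => τ i ω) ∈ A ∧ (fun i => ξ i ω) ∈ R} =
      P {ω | J₀ ω = j} * (P {ω | (fun i => τ i ω) ∈ A} * P {ω | (fun i => ξ i ω) ∈ R}) :=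
  (h.indep_init.measure_inter_preimage_eq_mul {j} (A ×ˢ R) (measurableSet_singleton j)
    (hA.prod hR)).trans
    (congrArg _ (h.indep_time_turn.measure_inter_preimage_eq_mul A R hA hR))

theorem IsDriving.measure_forall_turn_eq_two (h : IsDriving P lam p q J₀ τ ξ) (n : ℕ) :
    P {ω | ∀ m < n, ξ m ω = 2} = ENNReal.ofReal (1 - p - q) ^ n := by
  have hset : {ω | ∀ m < n, ξ m ω = 2} = ⋂ m ∈ Finset.range n, ξ m ⁻¹' {2} := by
    ext ω
    simp
  have hprod := h.indep_turn.measure_inter_preimage_eq_mul (Finset.range n) (sets := fun _ => {2})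
    fun _ _ => measurableSet_singleton _
  have hturn (m : ℕ) : P (ξ m ⁻¹' {2}) = ENNReal.ofReal (1 - p - q) := h.law_reflection m
  rw [hset, hprod]
  simp only [hturn, Finset.prod_const, Finset.card_range]

theorem IsDriving.measure_reflectionEvent (h : IsDriving P lam p q J₀ τ ξ) (hlam : 0 < lam)
    (hc : 0 < c) (hB : MeasurableSet B) (hBt : B ⊆ Ioo (-(c * t)) (c * t)) (n : ℕ) {j : ℕ}
    (hj : j < 2) :
    P (reflectionEvent c t J₀ τ ξ B (n + 1) j) =
      1 / 4 * (ENNReal.ofReal (1 / (2 * c)) * (∫⁻ x in B, ENNReal.ofReal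
        (flightDensity lam t (n / 2) ((n + 1) / 2) ((t - (-1) ^ (j + (n + 1)) * x / c) / 2))) *
          ENNReal.ofReal (1 - p - q) ^ (n + 1)) := by
  have hε : |(-1 : ℝ) ^ (j + (n + 1))| = 1 := abs_neg_one_pow _
  have hdur := measurableSet_durations hB c t ((-1) ^ (j + (n + 1)))
  refine (h.measure_init_time_turn (2 * j) (measurableSet_flightTimes hdur t (n + 1))
    (measurableSet_forall_lt_eq_two (n + 1))).trans ?_
  rw [h.law_init _ (by omega) (by omega), h.measure_flightTimes hlam hdur
    ((durations_subset_Ioo hc hε hBt).trans Ioo_subset_Icc_self), setLIntegral_durations hc hε]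
  exact congrArg _ (congrArg _ (h.measure_forall_turn_eq_two (n + 1)))

theorem sum_fin_two_comp_neg_one_pow {M : Type*} [AddCommMonoid M] (F : ℝ → M) (n : ℕ) :
    ∑ j : Fin 2, F ((-1) ^ ((j : ℕ) + n)) = F (-1) + F 1 := by
  rcases neg_one_pow_eq_or ℝ n with hn | hn <;> simp [pow_add, hn, add_comm]

theorem half_add_div_mem_Icc {x : ℝ} (hc : 0 < c) (hx : |x| ≤ c * t) :
    (t + x / c) / 2 ∈ Icc 0 t := by
  have hxc : |x / c| ≤ t := by rwa [abs_div, abs_of_pos hc, div_le_iff₀' hc]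
  constructor <;> linarith [abs_le.1 hxc]

theorem half_sub_div_mem_Icc {x : ℝ} (hc : 0 < c) (hx : |x| ≤ c * t) :
    (t - x / c) / 2 ∈ Icc 0 t := by
  simpa only [neg_div, ← sub_eq_add_neg] using half_add_div_mem_Icc hc ((abs_neg x).trans_le hx)

theorem IsDriving.sum_measure_reflectionEvent (h : IsDriving P lam p q J₀ τ ξ) (hlam : 0 < lam)
    (hpq : p + q ≤ 1) (hc : 0 < c) (hB : MeasurableSet B) (hBt : B ⊆ Ioo (-(c * t)) (c * t))
    (n : ℕ) :
    ∑ j : Fin 2, P (reflectionEvent c t J₀ τ ξ B (n + 1) j) =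
      ∫⁻ x in B, ENNReal.ofReal (1 / 4 * (1 - p - q) ^ (n + 1) * (1 / (2 * c) *
        (flightDensity lam t (n / 2) ((n + 1) / 2) ((t + x / c) / 2) +
          flightDensity lam t (n / 2) ((n + 1) / 2) ((t - x / c) / 2)))) := by
  set f := flightDensity lam t (n / 2) ((n + 1) / 2)
  have hf_meas : Measurable fun x => ENNReal.ofReal (f ((t + x / c) / 2)) := by fun_prop
  have hr : 0 ≤ 1 - p - q := by linarith
  have hquarter : (1 / 4 : ENNReal) = ENNReal.ofReal (1 / 4) := by
    rw [ENNReal.ofReal_div_of_pos four_pos, ENNReal.ofReal_one, ENNReal.ofReal_ofNat]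
  calc ∑ j : Fin 2, P (reflectionEvent c t J₀ τ ξ B (n + 1) j)
      = ∑ j : Fin 2, 1 / 4 * (ENNReal.ofReal (1 / (2 * c)) * (∫⁻ x in B,
          ENNReal.ofReal (f ((t - (-1) ^ ((j : ℕ) + (n + 1)) * x / c) / 2))) *
            ENNReal.ofReal (1 - p - q) ^ (n + 1)) :=
        Finset.sum_congr rfl fun j _ => h.measure_reflectionEvent hlam hc hB hBt n j.2
    _ = 1 / 4 * ENNReal.ofReal (1 - p - q) ^ (n + 1) * ENNReal.ofReal (1 / (2 * c)) *
          ∫⁻ x in B,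
            ENNReal.ofReal (f ((t + x / c) / 2)) + ENNReal.ofReal (f ((t - x / c) / 2)) := by
        rw [sum_fin_two_comp_neg_one_pow (fun ε => 1 / 4 * (ENNReal.ofReal (1 / (2 * c)) *
          (∫⁻ x in B, ENNReal.ofReal (f ((t - ε * x / c) / 2))) *
            ENNReal.ofReal (1 - p - q) ^ (n + 1))), lintegral_add_left hf_meas]
        simp only [neg_mul, one_mul, neg_div, sub_neg_eq_add]
        ring
    _ = _ := by
        rw [hquarter, ← ENNReal.ofReal_pow hr, ← ENNReal.ofReal_mul (by positivity),
          ← ENNReal.ofReal_mul (by positivity), ← lintegral_const_mul' _ _ ENNReal.ofReal_ne_top]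
        refine setLIntegral_congr_fun hB fun x hx => ?_
        have hxt : |x| ≤ c * t := (abs_lt.2 (hBt hx)).le
        rw [← ENNReal.ofReal_add
          (flightDensity_nonneg hlam.le _ _ (half_add_div_mem_Icc hc hxt))
          (flightDensity_nonneg hlam.le _ _ (half_sub_div_mem_Icc hc hxt)),
          ← ENNReal.ofReal_mul (by positivity), mul_assoc]

theorem IsDriving.ae_posX_mem_and_posY_eq_zero_iff (h : IsDriving P lam p q J₀ τ ξ)
    (hlam : 0 < lam) (hp : 0 ≤ p) (hq : 0 ≤ q) (hpq : p + q ≤ 1) (hc : c ≠ 0) (ht : 0 < t)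
    (B : Set ℝ) :
    ∀ᵐ ω ∂P, (posX c J₀ τ ξ t ω ∈ B ∧ posY c J₀ τ ξ t ω = 0) ↔
      ω ∈ ⋃ k : ℕ × Fin 2, reflectionEvent c t J₀ τ ξ B k.1 k.2 := by
  filter_upwards [h.ae_time_pos hlam, h.ae_exists_mem_Ico_arrival hlam ht.le,
    h.ae_posY_eq_zero_iff hlam hp hq hpq hc ht.ne'] with ω hpos hex hY
  simp only [mem_iUnion, mem_reflectionEvent_iff hpos, Prod.exists]
  constructor
  · rintro ⟨hX, hY₀⟩
    obtain ⟨n, hn⟩ := hex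
    obtain ⟨⟨j, hJ⟩, hξ⟩ := (hY n hn).1 hY₀
    exact ⟨n, j, hX, hn, hJ, hξ⟩
  · rintro ⟨n, j, hX, hn, hJ, hξ⟩
    exact ⟨hX, (hY n hn).2 ⟨⟨j, hJ⟩, hξ⟩⟩

theorem IsDriving.pairwise_aedisjoint_reflectionEvent (h : IsDriving P lam p q J₀ τ ξ)
    (hlam : 0 < lam) (c t : ℝ) (B : Set ℝ) :
    Pairwise (Function.onFun (AEDisjoint P)
      fun k : ℕ × Fin 2 => reflectionEvent c t J₀ τ ξ B k.1 k.2) := by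
  intro k l hkl
  refine measure_mono_null (fun ω hω (hpos : ∀ i, 0 < τ i ω) => hkl ?_)
    (ae_iff.1 (h.ae_time_pos hlam))
  obtain ⟨-, hk, hJk, -⟩ := (mem_reflectionEvent_iff hpos).1 hω.1
  obtain ⟨-, hl, hJl, -⟩ := (mem_reflectionEvent_iff hpos).1 hω.2
  exact Prod.ext ((count_eq hpos hk).symm.trans (count_eq hpos hl)) (Fin.ext (by omega))

theorem IsDriving.measure_posX_mem_and_posY_eq_zero_eq_tsum (h : IsDriving P lam p q J₀ τ ξ)
    (hlam : 0 < lam) (hp : 0 ≤ p) (hq : 0 ≤ q) (hpq : p + q ≤ 1) (hc : 0 < c) (ht : 0 < t)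
    (hB : MeasurableSet B) (hBt : B ⊆ Ioo (-(c * t)) (c * t)) :
    P {ω | posX c J₀ τ ξ t ω ∈ B ∧ posY c J₀ τ ξ t ω = 0} =
      ∑' n, ∑ j : Fin 2, P (reflectionEvent c t J₀ τ ξ B (n + 1) j) := by
  have hset : {ω | posX c J₀ τ ξ t ω ∈ B ∧ posY c J₀ τ ξ t ω = 0} =ᵐ[P]
      ⋃ k : ℕ × Fin 2, reflectionEvent c t J₀ τ ξ B k.1 k.2 :=
    Filter.eventuallyEq_set.2 (h.ae_posX_mem_and_posY_eq_zero_iff hlam hp hq hpq hc.ne' ht B)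
  rw [measure_congr hset, measure_iUnion₀ (h.pairwise_aedisjoint_reflectionEvent hlam c t B)
      fun k => (h.measurableSet_reflectionEvent c t hB k.1 k.2).nullMeasurableSet,
    ENNReal.tsum_prod (f := fun n (j : Fin 2) => P (reflectionEvent c t J₀ τ ξ B n j)),
    tsum_eq_zero_add' ENNReal.summable]
  simp only [reflectionEvent_zero hc hBt, measure_empty, tsum_fintype,
    Finset.sum_const_zero, zero_add]

theorem IsDriving.measure_posX_mem_and_posY_eq_zero (h : IsDriving P lam p q J₀ τ ξ)
    (hlam : 0 < lam) (hp : 0 ≤ p) (hq : 0 ≤ q) (hpq : p + q ≤ 1) (hc : 0 < c) (ht : 0 < t)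
    (hB : MeasurableSet B) (hBt : B ⊆ Ioo (-(c * t)) (c * t)) :
    P {ω | posX c J₀ τ ξ t ω ∈ B ∧ posY c J₀ τ ξ t ω = 0} =
      ∫⁻ x in B, ENNReal.ofReal (diagDensity lam c p q x t) := by
  have hr : 0 ≤ 1 - p - q := by linarith
  rw [h.measure_posX_mem_and_posY_eq_zero_eq_tsum hlam hp hq hpq hc ht hB hBt]
  simp only [h.sum_measure_reflectionEvent hlam hpq hc hB hBt]
  rw [← lintegral_tsum fun n => by fun_prop]
  refine setLIntegral_congr_fun hB fun x hx => ?_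
  have hxt : |x| < c * t := abs_lt.2 (hBt hx)
  have hsum := hasSum_diagDensity (lam := lam) (p := p) (q := q) hc hxt
  rw [← hsum.tsum_eq, ENNReal.ofReal_tsum_of_nonneg _ hsum.summable]
  intro n
  have hplus := flightDensity_nonneg hlam.le (n / 2) ((n + 1) / 2) (half_add_div_mem_Icc hc hxt.le)
  have hminus := flightDensity_nonneg hlam.le (n / 2) ((n + 1) / 2) (half_sub_div_mem_Icc hc hxt.le)
  positivity

end Law

end PlanarMotion

end

theorem mainTheorem6 {Ω : Type*} [MeasurableSpace Ω] (P : Measure Ω) [IsProbabilityMeasure P]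
    (lam c p q : ℝ) (hlam : 0 < lam) (hc : 0 < c) (hp : 0 ≤ p) (hq : 0 ≤ q) (hpq : p + q < 1)
    (J₀ : Ω → ℤ) (τ : ℕ → Ω → ℝ) (ξ : ℕ → Ω → ℤ)
    (hmotion : PlanarMotion.IsDriving P lam p q J₀ τ ξ)
    (t : ℝ) (ht : 0 < t) :
    (∀ x : ℝ, |x| < c * t →
      DifferentiableAt ℝ (fun s => PlanarMotion.besselTerm lam c p q x s) t ∧
      0 ≤ PlanarMotion.diagDensity lam c p q x t) ∧
    ContinuousOn (fun x => PlanarMotion.diagDensity lam c p q x t) (Ioo (-(c * t)) (c * t)) ∧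
    ∀ B : Set ℝ, MeasurableSet B → B ⊆ Ioo (-(c * t)) (c * t) →
      P {ω | PlanarMotion.posX c J₀ τ ξ t ω ∈ B ∧ PlanarMotion.posY c J₀ τ ξ t ω = 0} =
        ∫⁻ x in B, ENNReal.ofReal (PlanarMotion.diagDensity lam c p q x t) :=
  ⟨fun _ hx => ⟨(PlanarMotion.hasDerivAt_besselTerm hc hx).differentiableAt,
      PlanarMotion.diagDensity_nonneg hlam.le hc hpq.le hx⟩,
    PlanarMotion.continuousOn_diagDensity hc,
    fun _ hB hBt =>
      hmotion.measure_posX_mem_and_posY_eq_zero hlam hp hq hpq.le hc ht hB hBt⟩
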